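/- Let $M\ge 1$ and let $Q=(q_{jk})$ be an invertible $M\times M$ covariance matrix (so $Q$ is positive definite). Let $x_{t+1}=x_t+w_t$, $t=0,1,2,\dots$, be a random walk in $\mathbb{R}^M$, where the increments $w_0,w_1,\dots$ are i.i.d. with law $\mathcal N(0,Q)$ and the initial state $x_0$ has finite second moments and is independent of the increments. At each time $t$ exactly one sensor $\pi(t)\in\{1,\dots,M\}$ is scheduled and the monitor receives $y_t=x_t^{\pi(t)}$. The scheduling policy $\pi$ is oblivious: $\pi(t)$ is a measurable function of the past decisions $\pi(0),\dots,\pi(t-1)$, of the past samples $y_0,\dots,y_{t-1}$, and possibly of a random seed independent of $(x_0,w_0,w_1,\dots)$. Let $\hat x^i_t=\mathbb E[x^i_t\mid \pi(0),y_0,\dots,\pi(t),y_t]$ be the minimum mean square error estimate of the $i$-th process, and let $h_i(t)$ be the age of information of sensor $i$: $h_i(0)=0$ and, for $t\ge1$, $h_i(t)=0$ if $\pi(t)=i$ and $h_i(t)=h_i(t-1)+1$ otherwise. For each $i$ let $q_i=(q_{ji})_{j\ne i}\in\mathbb{R}^{M-1}$ be the vector of covariances of the increment of process $i$ with those of the other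 processes, let $Q_{-i}$ be the submatrix of $Q$ obtained by deleting row and column $i$, and let $\tilde q_{ii}=q_{ii}-q_i^{T}Q_{-i}^{-1}q_i$ (for $M=1$, $\tilde q_{11}=q_{11}$). Then, for every oblivious policy $\pi$, every $i$ and every $t\ge0$, $\tilde q_{ii}>0$, both expectations below are finite, and $$\mathbb E\big[(x^i_t-\hat x^i_t)^2\big]\;\ge\;\tilde q_{ii}\,\mathbb E[h_i(t)],$$ where the expectations are over the process and the randomness of the policy. -/

import Mathlib

open MeasureTheory ProbabilityTheory Matrix

noncomputable section

namespace Monitoring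

/-- The random walk `x_{t+1} = x_t + w_t` started at `x₀`. -/
def state {M : ℕ} {Ω : Type*} (x₀ : Ω → EuclideanSpace ℝ (Fin M))
    (w : ℕ → Ω → EuclideanSpace ℝ (Fin M)) : ℕ → Ω → EuclideanSpace ℝ (Fin M)
  | 0 => x₀
  | t + 1 => fun ω => state x₀ w t ω + w t ω

/-- A causal oblivious scheduling policy for `M` sensors, possibly randomized through a seed in
`S`: the sensor scheduled at time `t` is a measurable function of the seed and of the past
record, whose `s`-th entry (`s < t`) is the pair (sensor scheduled at time `s`, sample `y_s`). -/
structure ObliviousPolicy (M : ℕ) (S : Type*) [MeasurableSpace S] where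
  next : (t : ℕ) → S → (Fin t → Fin M × ℝ) → Fin M
  measurable_next : ∀ t : ℕ,
    Measurable (fun p : S × (Fin t → Fin M × ℝ) => next t p.1 p.2)

variable {M : ℕ} {S : Type*} [MeasurableSpace S] {Ω : Type*}

/-- The record of the scheduled sensors and received samples at the times `0, …, t - 1`, when
`pol` is run with seed `ξ` on the state process `x`: at each time `s` the scheduled sensor `j`
sends the sample `y_s = x^j_s`. -/
def record (pol : ObliviousPolicy M S) (ξ : Ω → S) (x : ℕ → Ω → EuclideanSpace ℝ (Fin M)) :
    (t : ℕ) → Ω → Fin t → Fin M × ℝ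
  | 0 => fun _ => Fin.elim0
  | t + 1 => fun ω =>
      Fin.snoc (α := fun _ => Fin M × ℝ) (record pol ξ x t ω)
        (pol.next t (ξ ω) (record pol ξ x t ω),
          x t ω (pol.next t (ξ ω) (record pol ξ x t ω)))

/-- The sensor `π(t)` scheduled at time `t`. -/
def schedule (pol : ObliviousPolicy M S) (ξ : Ω → S) (x : ℕ → Ω → EuclideanSpace ℝ (Fin M))
    (t : ℕ) (ω : Ω) : Fin M :=
  pol.next t (ξ ω) (record pol ξ x t ω)

/-- The information of the monitor at time `t`: the σ-algebra generated by the scheduling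
decisions and the received samples at the times `0, …, t`. -/
@[reducible] def info (pol : ObliviousPolicy M S) (ξ : Ω → S) (x : ℕ → Ω → EuclideanSpace ℝ (Fin M))
    (t : ℕ) : MeasurableSpace Ω :=
  MeasurableSpace.comap (record pol ξ x (t + 1)) inferInstance

/-- The MMSE estimate of `x^i_t` from the information of the monitor at time `t`. -/
def mmse [MeasurableSpace Ω] (μ : Measure Ω) (pol : ObliviousPolicy M S) (ξ : Ω → S)
    (x : ℕ → Ω → EuclideanSpace ℝ (Fin M)) (i : Fin M) (t : ℕ) : Ω → ℝ :=
  μ[fun ω => x t ω i | info pol ξ x t]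

/-- The age of information of sensor `i` under the schedule `σ`, started from age `0` at
time `0`. -/
def age (σ : ℕ → Fin M) (i : Fin M) : ℕ → ℕ
  | 0 => 0
  | t + 1 => if σ (t + 1) = i then 0 else age σ i t + 1

/-- The age of information of sensor `i` at time `t` under the policy `pol`. -/
def aoi (pol : ObliviousPolicy M S) (ξ : Ω → S) (x : ℕ → Ω → EuclideanSpace ℝ (Fin M))
    (i : Fin M) (t : ℕ) (ω : Ω) : ℝ :=
  (age (fun s => schedule pol ξ x s ω) i t : ℝ)

/-- The squared error of the MMSE estimate of process `i` at time `t`. -/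
def sqError [MeasurableSpace Ω] (μ : Measure Ω) (pol : ObliviousPolicy M S) (ξ : Ω → S)
    (x : ℕ → Ω → EuclideanSpace ℝ (Fin M)) (i : Fin M) (t : ℕ) (ω : Ω) : ℝ :=
  (x t ω i - mmse μ pol ξ x i t ω) ^ 2

/-- The covariances of the increments of process `i` with those of the other processes. -/
def crossCov (Q : Matrix (Fin M) (Fin M) ℝ) (i : Fin M) : {j : Fin M // j ≠ i} → ℝ :=
  fun j => Q j i

/-- The covariance submatrix of the processes other than `i`. -/
def othersCov (Q : Matrix (Fin M) (Fin M) ℝ) (i : Fin M) :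
    Matrix {j : Fin M // j ≠ i} {j : Fin M // j ≠ i} ℝ :=
  Q.submatrix Subtype.val Subtype.val

/-- The weight `q_ii - q_iᵀ Q_{-i}⁻¹ q_i`. -/
def qTilde (Q : Matrix (Fin M) (Fin M) ℝ) (i : Fin M) : ℝ :=
  Q i i - crossCov Q i ⬝ᵥ ((othersCov Q i)⁻¹ *ᵥ crossCov Q i)

end Monitoring

end

/-! Split each increment as `w = u + v e_i`, where `v` is what the other coordinates fail to predict
linearly in `w^i`. The vector `c` with `v = ⟨c, w⟩` satisfies `Q c = qTilde e_i`, so `v` has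
variance `qTilde`, and by Gaussianity `v` is independent of `u`.

On the event that the age is `k`, sensor `i` is silent during `t-k+1, …, t`. Deleting the
innovations `v_r`, `t-k ≤ r < t`, changes only `x^i` after time `t-k`, which nobody observes, so
record, estimate and age stay the same (`agree_predictFrom`). Hence, on this event, the error is the
error along the modified path plus `k` centered innovations. The modified error and the event are
functions of the modified path, hence independent of the deleted innovations (`indepFun_update`),
although the event depends on the process. Pythagoras (`integral_sq_add_sum_eq`) gives at least `k *
qTilde * P(age = k)`, and summing over `k ≤ t` gives the bound. Optimality of the estimate plays no
role: it only has to be a square-integrable function of the record. -/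

namespace Monitoring

/-! ### Gaussian regression of one coordinate on the others. -/

section Innovation

variable {M : ℕ}

/-- The vector `c` such that `⟨c, x⟩` is the difference between `x i` and its best linear
prediction from the other coordinates, when `x` has covariance matrix `Q`. -/
noncomputable def innovationVec (Q : Matrix (Fin M) (Fin M) ℝ) (i : Fin M) :
    EuclideanSpace ℝ (Fin M) :=
  WithLp.toLp 2 fun j =>
    if h : j ≠ i then -((othersCov Q i)⁻¹ *ᵥ crossCov Q i) ⟨j, h⟩ else 1

lemma innovationVec_self (Q : Matrix (Fin M) (Fin M) ℝ) (i : Fin M) :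
    innovationVec Q i i = 1 := by
  simp [innovationVec]

lemma mulVec_innovationVec_apply (Q : Matrix (Fin M) (Fin M) ℝ) (i k : Fin M) :
    (Q *ᵥ (innovationVec Q i).ofLp) k =
      Q k i - ∑ j : {j : Fin M // j ≠ i}, Q k j * ((othersCov Q i)⁻¹ *ᵥ crossCov Q i) j := by
  simp only [mulVec, dotProduct]
  rw [← Finset.add_sum_erase _ _ (Finset.mem_univ i), innovationVec_self, mul_one, sub_eq_add_neg,
    ← Finset.sum_neg_distrib]
  congr 1
  rw [Finset.sum_subtype (p := fun j => j ≠ i) (Finset.univ.erase i) (by simp)]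
  refine Finset.sum_congr rfl fun j _ => ?_
  simp [innovationVec, j.2, mulVec, dotProduct]

/-- The rows `k ≠ i` are the normal equations: the innovation is uncorrelated with every other
coordinate. Row `i` is the Schur complement. -/
lemma mulVec_innovationVec {Q : Matrix (Fin M) (Fin M) ℝ} (hQ : Q.PosDef) (i : Fin M) :
    Q *ᵥ (innovationVec Q i).ofLp = Pi.single i (qTilde Q i) := by
  have hsymm : ∀ j k, Q j k = Q k j := fun j k => by
    simpa using congrFun (congrFun hQ.1 k) j
  have hothers : IsUnit (othersCov Q i).det :=
    (Matrix.isUnit_iff_isUnit_det _).1 (hQ.submatrix Subtype.val_injective).isUnit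
  ext k
  rw [mulVec_innovationVec_apply]
  by_cases hk : k = i
  · subst hk
    rw [Pi.single_eq_same, qTilde]
    congr 1
    exact Finset.sum_congr rfl fun j _ => by rw [hsymm, crossCov]
  · rw [Pi.single_eq_of_ne hk]
    have h : othersCov Q i *ᵥ ((othersCov Q i)⁻¹ *ᵥ crossCov Q i) = crossCov Q i := by
      rw [mulVec_mulVec, Matrix.mul_nonsing_inv _ hothers, one_mulVec]
    have h' := congrFun h ⟨k, hk⟩
    simp only [crossCov] at h'
    rw [← h', sub_eq_zero]
    rfl

lemma qTilde_pos {Q : Matrix (Fin M) (Fin M) ℝ} (hQ : Q.PosDef) (i : Fin M) :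
    0 < qTilde Q i := by
  have hc : (innovationVec Q i).ofLp ≠ 0 := fun h => by
    simpa [h] using (innovationVec_self Q i)
  have h := hQ.dotProduct_mulVec_pos hc
  rw [mulVec_innovationVec hQ, dotProduct_single] at h
  simpa [innovationVec_self] using h

/-- The part of `x i` that the other coordinates do not predict. -/
noncomputable def innovation (Q : Matrix (Fin M) (Fin M) ℝ) (i : Fin M) :
    EuclideanSpace ℝ (Fin M) →L[ℝ] ℝ :=
  innerSL ℝ (innovationVec Q i)

/-- Replaces the `i`-th coordinate by its best linear prediction from the others. -/
noncomputable def prediction (Q : Matrix (Fin M) (Fin M) ℝ) (i : Fin M) :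
    EuclideanSpace ℝ (Fin M) →L[ℝ] EuclideanSpace ℝ (Fin M) :=
  ContinuousLinearMap.id ℝ _ - (innovation Q i).smulRight (EuclideanSpace.single i (1 : ℝ))

lemma prediction_apply_self (Q : Matrix (Fin M) (Fin M) ℝ) (i : Fin M)
    (x : EuclideanSpace ℝ (Fin M)) : prediction Q i x i = x i - innovation Q i x := by
  simp [prediction]

lemma prediction_apply_of_ne (Q : Matrix (Fin M) (Fin M) ℝ) {i j : Fin M} (h : j ≠ i)
    (x : EuclideanSpace ℝ (Fin M)) : prediction Q i x j = x j := by
  simp [prediction, h]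

lemma innovation_single (Q : Matrix (Fin M) (Fin M) ℝ) (i : Fin M) :
    innovation Q i (EuclideanSpace.single i (1 : ℝ)) = 1 := by
  simp [innovation, innovationVec_self, EuclideanSpace.inner_single_right]

lemma prediction_prediction (Q : Matrix (Fin M) (Fin M) ℝ) (i : Fin M)
    (x : EuclideanSpace ℝ (Fin M)) : prediction Q i (prediction Q i x) = prediction Q i x := by
  simp [prediction, innovation_single]

variable {Ω : Type*} [MeasurableSpace Ω] {μ : Measure Ω} {Q : Matrix (Fin M) (Fin M) ℝ}
  {X : Ω → EuclideanSpace ℝ (Fin M)}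

lemma hasGaussianLaw_of_map_eq (hlaw : μ.map X = multivariateGaussian 0 Q) :
    HasGaussianLaw X μ :=
  ⟨hlaw ▸ inferInstance⟩

lemma covariance_inner_of_map_eq (hQ : Q.PosSemidef) (hX : Measurable X)
    (hlaw : μ.map X = multivariateGaussian 0 Q) (a b : EuclideanSpace ℝ (Fin M)) :
    cov[fun ω => inner ℝ a (X ω), fun ω => inner ℝ b (X ω); μ] = a ⬝ᵥ Q *ᵥ b := by
  rw [← covarianceBilin_multivariateGaussian (μ := 0) hQ,
    covarianceBilin_apply_eq_cov IsGaussian.memLp_two_id, ← hlaw,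
    covariance_map (by fun_prop) (by fun_prop) hX.aemeasurable]
  rfl

/-- The two are jointly Gaussian, so it suffices that they are uncorrelated, which follows from `Q c
= qTilde e_i` and `c_i = 1`. -/
lemma indepFun_innovation_prediction (hQ : Q.PosDef) (hX : Measurable X)
    (hlaw : μ.map X = multivariateGaussian 0 Q) (i : Fin M) :
    IndepFun (fun ω => innovation Q i (X ω)) (fun ω => prediction Q i (X ω)) μ := by
  have hG := hasGaussianLaw_of_map_eq hlaw
  refine (hG.map_fun ((innovation Q i).prod (prediction Q i))).indepFun_of_covariance_inner
    fun a b => ?_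
  -- The adjoint of `prediction` sends `b` to `b - b_i c`, whose `i`-th entry is `0`.
  have hb : ∀ ω, inner ℝ b (prediction Q i (X ω)) =
      inner ℝ (b - b i • innovationVec Q i) (X ω) := fun ω => by
    simp [prediction, inner_sub_left, inner_sub_right, inner_smul_left, inner_smul_right,
      innovation, EuclideanSpace.inner_single_right, mul_comm]
  have ha : ∀ ω, inner ℝ a (innovation Q i (X ω)) = inner ℝ (a • innovationVec Q i) (X ω) :=
    fun ω => by simp [innovation, inner_smul_left, mul_comm]
  have hcov : cov[fun ω => inner ℝ a (innovation Q i (X ω)),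
      fun ω => inner ℝ b (prediction Q i (X ω)); μ] = 0 := by
    rw [funext ha, funext hb, covariance_comm, covariance_inner_of_map_eq hQ.posSemidef hX hlaw]
    simp [mulVec_smul, mulVec_innovationVec hQ, innovationVec_self]
  exact hcov

lemma memLp_innovation (hlaw : μ.map X = multivariateGaussian 0 Q) (i : Fin M) :
    MemLp (fun ω => innovation Q i (X ω)) 2 μ :=
  ((hasGaussianLaw_of_map_eq hlaw).map_fun (innovation Q i)).memLp_two

lemma integral_innovation (hX : Measurable X)
    (hlaw : μ.map X = multivariateGaussian 0 Q) (i : Fin M) :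
    ∫ ω, innovation Q i (X ω) ∂μ = 0 := by
  have h := (innovation Q i).integral_comp_comm (hasGaussianLaw_of_map_eq hlaw).integrable
  rw [h]
  have h0 : ∫ ω, X ω ∂μ = 0 := by
    have := integral_map (μ := μ) hX.aemeasurable
      (f := fun x : EuclideanSpace ℝ (Fin M) => x) (by fun_prop)
    rw [← this, hlaw, integral_id_multivariateGaussian]
  rw [h0, map_zero]

lemma integral_innovation_sq (hQ : Q.PosDef) (hX : Measurable X)
    (hlaw : μ.map X = multivariateGaussian 0 Q) (i : Fin M) :
    ∫ ω, innovation Q i (X ω) ^ 2 ∂μ = qTilde Q i := by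
  have := (hasGaussianLaw_of_map_eq hlaw).isProbabilityMeasure
  have h := covariance_inner_of_map_eq hQ.posSemidef hX hlaw (innovationVec Q i) (innovationVec Q i)
  have hv := covariance_self (μ := μ) (X := fun ω => innovation Q i (X ω))
    (memLp_innovation hlaw i).aestronglyMeasurable.aemeasurable
  have hv' := variance_of_integral_eq_zero
    (memLp_innovation hlaw i).aestronglyMeasurable.aemeasurable (integral_innovation hX hlaw i)
  rw [← hv', ← hv]
  refine h.trans ?_
  rw [mulVec_innovationVec hQ, dotProduct_single, innovationVec_self, one_mul]

end Innovation

/-! ### Independence of an innovation from everything else. -/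

section Independence

variable {Ω : Type*} [MeasurableSpace Ω] {μ : Measure Ω}

lemma indepFun_prodMk_right [IsProbabilityMeasure μ] {α β γ : Type*} [MeasurableSpace α] [MeasurableSpace β]
    [MeasurableSpace γ] {X : Ω → α} {Y : Ω → β} {Z : Ω → γ} (hX : Measurable X)
    (hY : Measurable Y) (hZ : Measurable Z) (hXY : IndepFun X Y μ)
    (hXYZ : IndepFun (fun ω => (X ω, Y ω)) Z μ) : IndepFun X (fun ω => (Y ω, Z ω)) μ := by
  have h1 := (indepFun_iff_map_prod_eq_prod_map_map hX.aemeasurable hY.aemeasurable).1 hXY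
  have h2 := (indepFun_iff_map_prod_eq_prod_map_map (hX.prodMk hY).aemeasurable
    hZ.aemeasurable).1 hXYZ
  have h3 := (indepFun_iff_map_prod_eq_prod_map_map hY.aemeasurable hZ.aemeasurable).1
    (hXYZ.comp measurable_snd measurable_id)
  have := Measure.isProbabilityMeasure_map (μ := μ) hX.aemeasurable
  have := Measure.isProbabilityMeasure_map (μ := μ) hY.aemeasurable
  have := Measure.isProbabilityMeasure_map (μ := μ) hZ.aemeasurable
  rw [indepFun_iff_map_prod_eq_prod_map_map hX.aemeasurable (hY.prodMk hZ).aemeasurable]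
  have h4 : μ.map (fun ω => (X ω, Y ω, Z ω)) =
      (μ.map (fun ω => ((X ω, Y ω), Z ω))).map MeasurableEquiv.prodAssoc := by
    rw [Measure.map_map (by fun_prop) (by fun_prop)]
    rfl
  have h5 : μ.map (fun ω => (Y ω, Z ω)) = (μ.map Y).prod (μ.map Z) := h3
  rw [h4, h2, h1, h5, Measure.prodAssoc_prod]

lemma indepFun_eval_update {ι E : Type*} [DecidableEq ι] [MeasurableSpace E] {w : ι → Ω → E}
    (hw : ∀ i, Measurable (w i)) (h : iIndepFun w μ) (i : ι) (e : E) :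
    IndepFun (w i) (fun ω => Function.update (fun j => w j ω) i e) μ := by
  have h' := indep_iSup_of_disjoint (fun j => (hw j).comap_le) h.iIndep
    (S := {i}) (T := {i}ᶜ) (by simp)
  refine (indep_of_indep_of_le_right (indep_of_indep_of_le_left h' ?_) ?_)
  · exact le_iSup₂_of_le i rfl le_rfl
  · rw [← measurable_iff_comap_le, @measurable_pi_iff]
    intro j
    by_cases hj : j = i
    · subst hj
      simp
    · simp only [Function.update_of_ne hj]
      rw [measurable_iff_comap_le]
      exact le_iSup₂_of_le (f := fun j _ => MeasurableSpace.comap (w j) inferInstance) j hj le_rfl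

/-- Replacing one of the independent increments by a function of it that is independent of `v`
makes the whole collection independent of `v`. -/
lemma indepFun_update [IsProbabilityMeasure μ] {S α ι E : Type*} [DecidableEq ι] [MeasurableSpace S] [MeasurableSpace α]
    [MeasurableSpace E] {ξ : Ω → S} {x₀ : Ω → α} {w : ι → Ω → E} (hξ : Measurable ξ)
    (hx₀ : Measurable x₀) (hw : ∀ i, Measurable (w i)) (hwindep : iIndepFun w μ)
    (hx₀w : IndepFun x₀ (fun ω t => w t ω) μ)
    (hξxw : IndepFun ξ (fun ω => (x₀ ω, fun t => w t ω)) μ) (i : ι)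
    {v : E → ℝ} {u : E → E} (hv : Measurable v) (hu : Measurable u)
    (huv : IndepFun (fun ω => v (w i ω)) (fun ω => u (w i ω)) μ) :
    IndepFun (fun ω => v (w i ω))
      (fun ω => (ξ ω, x₀ ω, Function.update (fun j => w j ω) i (u (w i ω)))) μ := by
  -- `w i ω₀` is only an arbitrary constant to fill slot `i`, leaving the family of the other
  -- increments; `u (w i)` is put there afterwards.
  obtain ⟨ω₀⟩ : Nonempty Ω := μ.nonempty_of_neZero
  have hupd : Measurable fun ω => Function.update (fun j => w j ω) i (w i ω₀) :=
    measurable_update'.comp ((measurable_pi_lambda _ hw).prodMk measurable_const)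
  have h1 := indepFun_prodMk_right (hv.comp (hw i)) (hu.comp (hw i)) hupd huv
    ((indepFun_eval_update hw hwindep i (w i ω₀)).comp (hv.prodMk hu) measurable_id)
  have hU : Measurable fun f : ι → E => Function.update f i (u (f i)) :=
    measurable_update'.comp (measurable_id.prodMk (hu.comp (measurable_pi_apply i)))
  have hW : Measurable fun ω => Function.update (fun j => w j ω) i (u (w i ω)) :=
    hU.comp (measurable_pi_lambda _ hw)
  have h2 : IndepFun (fun ω => v (w i ω))
      (fun ω => Function.update (fun j => w j ω) i (u (w i ω))) μ := by
    have := h1.comp measurable_id ((measurable_update' (a := i)).comp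
      (measurable_snd.prodMk measurable_fst))
    simpa [Function.comp_def] using this
  have hvU : Measurable fun f : ι → E => (v (f i), Function.update f i (u (f i))) :=
    (hv.comp (measurable_pi_apply i)).prodMk hU
  have h3 := indepFun_prodMk_right (hv.comp (hw i)) hW hx₀ h2
    (hx₀w.symm.comp hvU measurable_id)
  have h4 := indepFun_prodMk_right (hv.comp (hw i)) (hW.prodMk hx₀) hξ h3
    (hξxw.symm.comp (φ := fun p : α × (ι → E) =>
      (v (p.2 i), Function.update p.2 i (u (p.2 i)), p.1))
      ((hv.comp ((measurable_pi_apply i).comp measurable_snd)).prodMk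
        ((hU.comp measurable_snd).prodMk measurable_fst)) measurable_id)
  exact h4.comp (ψ := fun p : ((ι → E) × α) × S => (p.2, p.1.2, p.1.1)) measurable_id
    (by fun_prop)

end Independence

/-! ### Second moments under independent centered noise. -/

section Pythagoras

variable {Ω : Type*} [MeasurableSpace Ω] {μ : Measure Ω}

/-- Adding to `Y`, on the event with indicator `b`, independent centered noises of variance `q`
adds `q * P(b)` to its second moment for each of them. -/
lemma integral_sq_add_sum_eq {b Y : Ω → ℝ} {v : ℕ → Ω → ℝ} {q : ℝ} (F : Finset ℕ)
    (hb : Measurable b) (hb01 : ∀ ω, b ω = 0 ∨ b ω = 1) (hY : MemLp Y 2 μ)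
    (hbY : ∀ ω, b ω * Y ω = Y ω) (hv : ∀ r, MemLp (v r) 2 μ)
    (hv0 : ∀ r, ∫ ω, v r ω ∂μ = 0) (hvq : ∀ r, ∫ ω, v r ω ^ 2 ∂μ = q)
    (hindep : ∀ r ∈ F, IndepFun (v r)
      (fun ω => ((b ω, Y ω), Function.update (fun r' => v r' ω) r 0)) μ) :
    ∫ ω, (Y ω + b ω * ∑ r ∈ F, v r ω) ^ 2 ∂μ =
      ∫ ω, Y ω ^ 2 ∂μ + F.card * (q * ∫ ω, b ω ∂μ) := by
  have hbv : ∀ f : Ω → ℝ, MemLp f 2 μ → MemLp (fun ω => b ω * f ω) 2 μ := fun f hf =>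
    hf.mono (hb.aestronglyMeasurable.mul hf.aestronglyMeasurable) (ae_of_all _ fun ω => by
      rcases hb01 ω with h | h <;> simp [h])
  induction F using Finset.induction_on with
  | empty => simp
  | insert r F hr ih =>
    specialize ih fun r' hr' => hindep r' (Finset.mem_insert_of_mem hr')
    have hi := hindep r (Finset.mem_insert_self _ _)
    set G : Ω → ℝ := fun ω => Y ω + b ω * ∑ r ∈ F, v r ω with hG
    have hG2 : MemLp G 2 μ := hY.add (hbv _ (memLp_finsetSum _ fun r _ => hv r))
    -- `G` involves only noises with index other than `r`, so setting the `r`-th to `0` does not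
    -- change it.
    have hGv : IndepFun G (v r) μ := by
      have : IndepFun _ (v r) μ := (hi.comp (φ := id) (ψ := fun p : (ℝ × ℝ) × (ℕ → ℝ) =>
        p.1.2 + p.1.1 * ∑ r ∈ F, p.2 r) measurable_id (by fun_prop)).symm
      convert this using 1
      ext ω
      simp only [hG, Function.comp]
      congr 2
      refine Finset.sum_congr rfl fun r' hr' => ?_
      rw [Function.update_of_ne (ne_of_mem_of_not_mem hr' hr)]
    have hbv2 : IndepFun b (fun ω => v r ω ^ 2) μ :=
      (hi.comp (φ := fun x => x ^ 2) (ψ := fun p : (ℝ × ℝ) × (ℕ → ℝ) => p.1.1)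
        (by fun_prop) (by fun_prop)).symm
    have hbb : ∀ ω, b ω * b ω = b ω := fun ω => by rcases hb01 ω with h | h <;> simp [h]
    have hGb : ∀ ω, b ω * G ω = G ω := fun ω => by
      simp only [hG, mul_add, ← mul_assoc, hbb, hbY]
    -- The cross term will vanish because `v r` is centered and independent of `G`; the last term
    -- gives `q * P(b)`.
    have hexp : ∀ ω, (Y ω + b ω * ∑ r ∈ insert r F, v r ω) ^ 2 =
        G ω ^ 2 + 2 * (G ω * v r ω) + b ω * v r ω ^ 2 := fun ω => by
      rw [Finset.sum_insert hr]
      linear_combination (2 * v r ω) * hGb ω + v r ω ^ 2 * hbb ω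
    have i1 : Integrable (fun ω => G ω ^ 2) μ := hG2.integrable_sq
    have i2 : Integrable (fun ω => 2 * (G ω * v r ω)) μ := (hG2.integrable_mul (hv r)).const_mul 2
    have i3 : Integrable (fun ω => b ω * v r ω ^ 2) μ :=
      (hv r).integrable_sq.mono
        (hb.aestronglyMeasurable.mul (hv r).integrable_sq.aestronglyMeasurable)
        (ae_of_all _ fun ω => by rcases hb01 ω with h | h <;> simp [h, sq_nonneg])
    have i12 : Integrable (fun ω => G ω ^ 2 + 2 * (G ω * v r ω)) μ := i1.add i2
    simp_rw [hexp]
    rw [integral_add i12 i3, integral_add i1 i2, ih, integral_const_mul,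
      hGv.integral_fun_mul_eq_mul_integral hG2.aestronglyMeasurable (hv r).aestronglyMeasurable,
      hbv2.integral_fun_mul_eq_mul_integral hb.aestronglyMeasurable
        (hv r).integrable_sq.aestronglyMeasurable,
      hv0, hvq, Finset.card_insert_of_notMem hr]
    push_cast
    ring

end Pythagoras

/-! ### Combinatorics of the age. -/

section Age

variable {M : ℕ} {i : Fin M}

lemma age_le (σ : ℕ → Fin M) (i : Fin M) (t : ℕ) : age σ i t ≤ t := by
  induction t with
  | zero => simp [age]
  | succ t ih =>
    simp only [age]
    split_ifs <;> omega

/-- The age counts the steps since the last reset. The strict bound excludes time `0`, where the age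
is `0` whatever the schedule. -/
lemma ne_of_sub_age_lt (σ : ℕ → Fin M) (i : Fin M) {t r : ℕ} (h : t - age σ i t < r)
    (hr : r ≤ t) : σ r ≠ i := by
  induction t with
  | zero => omega
  | succ t ih =>
    simp only [age] at h
    split_ifs at h with hσ
    · omega
    · rcases Nat.lt_or_eq_of_le hr with hr' | rfl
      · exact ih (by omega) (by omega)
      · exact hσ

lemma age_congr {σ σ' : ℕ → Fin M} {t : ℕ} (h : ∀ r ≤ t, σ r = σ' r) :
    age σ i t = age σ' i t := by
  induction t with
  | zero => rfl
  | succ t ih =>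
    simp only [age, h (t + 1) le_rfl, ih fun r hr => h r (by omega)]

end Age

/-! ### Dependence of the record on the process, and measurability. -/

section Record

variable {M : ℕ} {S : Type*} [MeasurableSpace S] {Ω Ω' : Type*} {pol : ObliviousPolicy M S}

lemma state_comp (f : Ω → Ω') (x₀ : Ω' → EuclideanSpace ℝ (Fin M))
    (w : ℕ → Ω' → EuclideanSpace ℝ (Fin M)) (t : ℕ) (ω : Ω) :
    state (fun ω => x₀ (f ω)) (fun s ω => w s (f ω)) t ω = state x₀ w t (f ω) := by
  induction t with
  | zero => rfl
  | succ t ih => simp only [state, ih]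

lemma record_comp (f : Ω → Ω') (ξ : Ω' → S) (x : ℕ → Ω' → EuclideanSpace ℝ (Fin M)) (t : ℕ)
    (ω : Ω) :
    record pol (fun ω => ξ (f ω)) (fun s ω => x s (f ω)) t ω = record pol ξ x t (f ω) := by
  induction t with
  | zero => rfl
  | succ t ih => simp only [record, ih]

/-- If sensor `i` is not scheduled after time `s`, then the record does not depend on the `i`-th
process after time `s`. -/
lemma record_eq_of_agree {i : Fin M} {s t : ℕ} {ξ : Ω → S}
    {x : ℕ → Ω → EuclideanSpace ℝ (Fin M)} {p p' : Ω} (hξ : ξ p = ξ p')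
    (hother : ∀ r, ∀ j ≠ i, x r p j = x r p' j) (hpast : ∀ r ≤ s, x r p i = x r p' i)
    (hs : ∀ r, s < r → r ≤ t → schedule pol ξ x r p ≠ i) {r : ℕ} (hr : r ≤ t + 1) :
    record pol ξ x r p = record pol ξ x r p' := by
  induction r with
  | zero => rfl
  | succ r ih =>
    specialize ih (by omega)
    simp only [record, ← ih, ← hξ]
    congr 2
    by_cases hj : pol.next r (ξ p) (record pol ξ x r p) = i
    · rw [hj]
      by_cases hrs : r ≤ s
      · exact hpast r hrs
      · exact absurd hj (hs r (by omega) (by omega))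
    · exact hother r _ hj

variable [MeasurableSpace Ω]

lemma measurable_state {x₀ : Ω → EuclideanSpace ℝ (Fin M)}
    {w : ℕ → Ω → EuclideanSpace ℝ (Fin M)} (hx₀ : Measurable x₀) (hw : ∀ t, Measurable (w t))
    (t : ℕ) : Measurable (state x₀ w t) := by
  induction t with
  | zero => exact hx₀
  | succ t ih => exact ih.add (hw t)

lemma memLp_state {μ : Measure Ω} {x₀ : Ω → EuclideanSpace ℝ (Fin M)}
    {w : ℕ → Ω → EuclideanSpace ℝ (Fin M)} (hx₀ : MemLp x₀ 2 μ) (hw : ∀ t, MemLp (w t) 2 μ)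
    (t : ℕ) : MemLp (state x₀ w t) 2 μ := by
  induction t with
  | zero => exact hx₀
  | succ t ih => exact ih.add (hw t)

variable {ξ : Ω → S} {x : ℕ → Ω → EuclideanSpace ℝ (Fin M)}

lemma measurable_record (hξ : Measurable ξ) (hx : ∀ t, Measurable (x t)) (t : ℕ) :
    Measurable (record pol ξ x t) := by
  induction t with
  | zero => exact measurable_pi_lambda _ fun k => k.elim0
  | succ t ih =>
    have hnext : Measurable fun ω => pol.next t (ξ ω) (record pol ξ x t ω) :=
      (pol.measurable_next t).comp (hξ.prodMk ih)
    have heval : Measurable fun p : EuclideanSpace ℝ (Fin M) × Fin M => p.1 p.2 :=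
      measurable_from_prod_countable_left fun j =>
        (by fun_prop : Measurable fun x : EuclideanSpace ℝ (Fin M) => x j)
    refine measurable_pi_lambda _ fun k => ?_
    induction k using Fin.lastCases with
    | last =>
      simp only [record, Fin.snoc_last]
      exact hnext.prodMk (heval.comp ((hx t).prodMk hnext))
    | cast k =>
      simp only [record, Fin.snoc_castSucc]
      exact (measurable_pi_apply k).comp ih

lemma measurable_schedule (hξ : Measurable ξ) (hx : ∀ t, Measurable (x t)) (t : ℕ) :
    Measurable (schedule pol ξ x t) :=
  (pol.measurable_next t).comp (hξ.prodMk (measurable_record hξ hx t))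

lemma measurable_age_schedule (hξ : Measurable ξ) (hx : ∀ t, Measurable (x t)) (i : Fin M)
    (t : ℕ) : Measurable fun ω => age (fun s => schedule pol ξ x s ω) i t := by
  induction t with
  | zero => exact measurable_const
  | succ t ih =>
    exact Measurable.ite (measurable_schedule hξ hx (t + 1) (measurableSet_singleton i))
      measurable_const (ih.add_const 1)

end Record

/-! ### Deleting innovations along a sample path. -/

section Path

variable {M : ℕ} {S : Type*}

/-- The sample paths of the seed, the initial state and the increments. -/
abbrev Path (M : ℕ) (S : Type*) : Type _ :=
  S × EuclideanSpace ℝ (Fin M) × (ℕ → EuclideanSpace ℝ (Fin M))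

/-- The random walk along a sample path. -/
def pathState : ℕ → Path M S → EuclideanSpace ℝ (Fin M) :=
  state (fun p => p.2.1) fun t p => p.2.2 t

/-- The sample path in which the increments of process `i` from time `s` on are replaced by
their predictions from the other processes. -/
noncomputable def predictFrom (Q : Matrix (Fin M) (Fin M) ℝ) (i : Fin M) (s : ℕ)
    (p : Path M S) : Path M S :=
  (p.1, p.2.1, fun r => if s ≤ r then prediction Q i (p.2.2 r) else p.2.2 r)

/-- The age of sensor `i` along a sample path. -/
def pathAge [MeasurableSpace S] (pol : ObliviousPolicy M S) (i : Fin M) (t : ℕ) (p : Path M S) : ℕ :=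
  age (fun s => schedule pol Prod.fst pathState s p) i t

lemma measurable_pathState [MeasurableSpace S] (t : ℕ) : Measurable (pathState (M := M) (S := S) t) :=
  measurable_state (by fun_prop) (by fun_prop) t

lemma measurable_pathAge [MeasurableSpace S] (pol : ObliviousPolicy M S) (i : Fin M) (t : ℕ) :
    Measurable (pathAge pol i t) :=
  measurable_age_schedule measurable_fst measurable_pathState i t

lemma measurable_predictFrom [MeasurableSpace S] (Q : Matrix (Fin M) (Fin M) ℝ) (i : Fin M) (s : ℕ) :
    Measurable (predictFrom (S := S) Q i s) := by
  refine measurable_fst.prodMk ((measurable_fst.comp measurable_snd).prodMk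
    (measurable_pi_lambda _ fun r => ?_))
  split_ifs <;> fun_prop

lemma pathState_predictFrom_of_ne (Q : Matrix (Fin M) (Fin M) ℝ) {i j : Fin M} (hj : j ≠ i)
    (s t : ℕ) (p : Path M S) : pathState t (predictFrom Q i s p) j = pathState t p j := by
  induction t with
  | zero => rfl
  | succ t ih =>
    simp only [pathState, state, PiLp.add_apply] at ih ⊢
    rw [ih]
    congr 1
    simp only [predictFrom]
    split_ifs
    · exact prediction_apply_of_ne Q hj _
    · rfl

lemma pathState_predictFrom_self (Q : Matrix (Fin M) (Fin M) ℝ) (i : Fin M)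
    (s t : ℕ) (p : Path M S) :
    pathState t (predictFrom Q i s p) i =
      pathState t p i - ∑ r ∈ Finset.Ico s t, innovation Q i (p.2.2 r) := by
  induction t with
  | zero => simp [pathState, state, predictFrom]
  | succ t ih =>
    simp only [pathState, state, PiLp.add_apply] at ih ⊢
    rw [ih]
    by_cases hs : s ≤ t
    · rw [Finset.sum_Ico_succ_top hs]
      simp only [predictFrom, hs, if_true, prediction_apply_self]
      ring
    · rw [Finset.Ico_eq_empty (by omega), Finset.Ico_eq_empty (by omega)]
      simp [predictFrom, hs]

/-- By idempotence of `prediction`, the modified path sees `w r` only through its predicted part;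
this is what makes it independent of the innovation at time `r`. -/
lemma predictFrom_update (Q : Matrix (Fin M) (Fin M) ℝ) (i : Fin M) {s r : ℕ} (hr : s ≤ r)
    (p : Path M S) :
    predictFrom Q i s (p.1, p.2.1, Function.update p.2.2 r (prediction Q i (p.2.2 r))) =
      predictFrom Q i s p := by
  simp only [predictFrom, Prod.mk.injEq, true_and]
  funext r'
  by_cases h : r' = r
  · subst h
    simp [hr, prediction_prediction]
  · simp [Function.update_of_ne h]

/-- Both directions are allowed in `hpp` so that the event `age = k` transfers from the original
path to the modified one and back. -/
lemma agree_predictFrom [MeasurableSpace S] {pol : ObliviousPolicy M S} (Q : Matrix (Fin M) (Fin M) ℝ) {i : Fin M}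
    {k t : ℕ} {p p' : Path M S}
    (hpp : p' = predictFrom Q i (t - k) p ∨ p = predictFrom Q i (t - k) p')
    (h : pathAge pol i t p = k) :
    record pol Prod.fst pathState (t + 1) p = record pol Prod.fst pathState (t + 1) p' ∧
      pathAge pol i t p' = k := by
  -- The first modified increment, `w_{t-k}`, enters the state only at time `t-k+1`.
  have hself : ∀ q : Path M S, ∀ r ≤ t - k,
      pathState r (predictFrom Q i (t - k) q) i = pathState r q i := fun q r hr => by
    rw [pathState_predictFrom_self, Finset.Ico_eq_empty (by omega), Finset.sum_empty, sub_zero]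
  have hrec : ∀ r ≤ t + 1,
      record pol Prod.fst pathState r p = record pol Prod.fst pathState r p' := by
    intro r hr
    refine record_eq_of_agree (i := i) (s := t - k) (t := t) ?_ ?_ ?_ ?_ hr
    · rcases hpp with rfl | rfl <;> rfl
    · intro r j hj
      rcases hpp with rfl | rfl
      · exact (pathState_predictFrom_of_ne Q hj _ r p).symm
      · exact pathState_predictFrom_of_ne Q hj _ r p'
    · intro r hr
      rcases hpp with rfl | rfl
      · exact (hself p r hr).symm
      · exact hself p' r hr
    · intro r hr hrt
      subst h
      exact ne_of_sub_age_lt (fun s => schedule pol Prod.fst pathState s p) i hr hrt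
  refine ⟨hrec _ le_rfl, ?_⟩
  rw [← h]
  refine age_congr fun r hr => ?_
  have hfst : p'.1 = p.1 := by rcases hpp with rfl | rfl <;> rfl
  simp only [schedule, hrec r (by omega), hfst]

end Path

/-! ### The bound on each event of constant age. -/

section LowerBound

variable {M : ℕ} {Ω S : Type*} [MeasurableSpace S] {Q : Matrix (Fin M) (Fin M) ℝ}
  {x₀ : Ω → EuclideanSpace ℝ (Fin M)} {w : ℕ → Ω → EuclideanSpace ℝ (Fin M)} {ξ : Ω → S}
  {pol : ObliviousPolicy M S}

lemma aoi_eq_pathAge (pol : ObliviousPolicy M S) (ξ : Ω → S)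
    (x₀ : Ω → EuclideanSpace ℝ (Fin M)) (w : ℕ → Ω → EuclideanSpace ℝ (Fin M)) (i : Fin M)
    (t : ℕ) (ω : Ω) :
    aoi pol ξ (state x₀ w) i t ω = pathAge pol i t (ξ ω, x₀ ω, fun r => w r ω) := by
  have hstate : state x₀ w = fun s ω => pathState s (ξ ω, x₀ ω, fun r => w r ω) := by
    funext s ω
    exact state_comp (fun ω => (ξ ω, x₀ ω, fun r => w r ω)) (fun p : Path M S => p.2.1)
      (fun t p => p.2.2 t) s ω
  rw [aoi, pathAge, hstate]
  congr 2
  funext s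
  have := record_comp (pol := pol) (fun ω => (ξ ω, x₀ ω, fun r => w r ω))
    (Prod.fst : Path M S → S) pathState s ω
  simp only [schedule, ← this]

/-- On the event that sensor `i` has age `k`, the mean squared error of any estimate that is a
function of the record is at least `k` times the weight of process `i`. -/
lemma mul_integral_indicator_le [MeasurableSpace Ω] {μ : Measure Ω} [IsProbabilityMeasure μ]
    (hQ : Q.PosDef) (hx₀ : Measurable x₀)
    (hw : ∀ t, Measurable (w t)) (hξ : Measurable ξ) (hx₀2 : MemLp x₀ 2 μ)
    (hwlaw : ∀ t, μ.map (w t) = multivariateGaussian 0 Q) (hwindep : iIndepFun w μ)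
    (hx₀w : IndepFun x₀ (fun ω t => w t ω) μ)
    (hξxw : IndepFun ξ (fun ω => (x₀ ω, fun t => w t ω)) μ) (i : Fin M) {k t : ℕ} (hk : k ≤ t)
    {g : (Fin (t + 1) → Fin M × ℝ) → ℝ} (hg : Measurable g)
    (hg2 : MemLp (fun ω => g (record pol ξ (state x₀ w) (t + 1) ω)) 2 μ) :
    k * (qTilde Q i *
        ∫ ω, (if pathAge pol i t (ξ ω, x₀ ω, fun r => w r ω) = k then (1 : ℝ) else 0) ∂μ) ≤
      ∫ ω, (if pathAge pol i t (ξ ω, x₀ ω, fun r => w r ω) = k then (1 : ℝ) else 0) *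
        (state x₀ w t ω i - g (record pol ξ (state x₀ w) (t + 1) ω)) ^ 2 ∂μ := by
  set P : Ω → Path M S := fun ω => (ξ ω, x₀ ω, fun r => w r ω) with hP
  have hPm : Measurable P := hξ.prodMk (hx₀.prodMk (measurable_pi_lambda _ hw))
  have hstate : state x₀ w = fun s ω => pathState s (P ω) := by
    funext s ω
    exact state_comp P (fun p : Path M S => p.2.1) (fun t p => p.2.2 t) s ω
  have hrecord : ∀ ω, record pol ξ (state x₀ w) (t + 1) ω =
      record pol Prod.fst pathState (t + 1) (P ω) := fun ω => by
    rw [hstate]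
    exact record_comp P Prod.fst pathState (t + 1) ω
  set s := t - k with hs
  set B : Path M S → ℝ := fun p => if pathAge pol i t p = k then 1 else 0 with hB
  have hBm : Measurable B := Measurable.ite
    (measurable_pathAge pol i t (measurableSet_singleton k)) measurable_const measurable_const
  have hB01 : ∀ p, B p = 0 ∨ B p = 1 := fun p => by
    simp only [hB]
    split_ifs <;> simp
  set Z : Path M S → ℝ := fun p =>
    pathState t p i - g (record pol Prod.fst pathState (t + 1) p) with hZ
  have hZm : Measurable Z := Measurable.sub
    ((by fun_prop : Measurable fun x : EuclideanSpace ℝ (Fin M) => x i).comp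
      (measurable_pathState t))
    (hg.comp (measurable_record measurable_fst measurable_pathState _))
  have herr : ∀ ω, state x₀ w t ω i - g (record pol ξ (state x₀ w) (t + 1) ω) = Z (P ω) :=
    fun ω => by rw [hrecord, hstate]
  -- The event is determined by the modified path, hence is independent of each deleted innovation.
  have hBp : ∀ p, B (predictFrom Q i s p) = B p := fun p => by
    simp only [hB]
    refine if_congr ⟨fun h => ?_, fun h => ?_⟩ rfl rfl
    · exact (agree_predictFrom Q (Or.inr rfl) h).2
    · exact (agree_predictFrom Q (Or.inl rfl) h).2
  have hdecomp : ∀ p, B p * Z p = B p * Z (predictFrom Q i s p) +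
      B p * ∑ r ∈ Finset.Ico s t, innovation Q i (p.2.2 r) := fun p => by
    by_cases h : pathAge pol i t p = k
    · simp only [hZ, pathState_predictFrom_self, (agree_predictFrom Q (Or.inl rfl) h).1, ← hs]
      ring
    · simp [hB, h]
  have hvL : ∀ r, MemLp (fun ω => innovation Q i (w r ω)) 2 μ := fun r =>
    memLp_innovation (hwlaw r) i
  have hBL : ∀ f : Ω → ℝ, MemLp f 2 μ → MemLp (fun ω => B (P ω) * f ω) 2 μ := fun f hf =>
    hf.mono ((hBm.comp hPm).aestronglyMeasurable.mul hf.aestronglyMeasurable)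
      (ae_of_all _ fun ω => by rcases hB01 (P ω) with h | h <;> simp [h])
  have hxL : MemLp (fun ω => state x₀ w t ω i) 2 μ :=
    (EuclideanSpace.proj i : EuclideanSpace ℝ (Fin M) →L[ℝ] ℝ).comp_memLp'
      (memLp_state hx₀2 (fun t => (hasGaussianLaw_of_map_eq (hwlaw t)).memLp_two) t)
  have hZL : MemLp (fun ω => Z (P ω)) 2 μ :=
    (hxL.sub hg2).ae_eq (ae_of_all _ herr)
  have hYL : MemLp (fun ω => B (P ω) * Z (predictFrom Q i s (P ω))) 2 μ := by
    -- Integrability is read off from the decomposition, avoiding a study of the modified walk.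
    have := (hBL _ hZL).sub (hBL _ (memLp_finsetSum (Finset.Ico s t) fun r _ => hvL r))
    refine this.ae_eq (ae_of_all _ fun ω => ?_)
    have := hdecomp (P ω)
    simp only [Pi.sub_apply]
    linarith
  have key := integral_sq_add_sum_eq (μ := μ) (b := fun ω => B (P ω))
    (Y := fun ω => B (P ω) * Z (predictFrom Q i s (P ω)))
    (v := fun r ω => innovation Q i (w r ω)) (q := qTilde Q i) (Finset.Ico s t)
    (hBm.comp hPm) (fun ω => hB01 (P ω)) hYL
    (fun ω => by rcases hB01 (P ω) with h | h <;> simp [h]) hvL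
    (fun r => integral_innovation (hw r) (hwlaw r) i)
    (fun r => integral_innovation_sq hQ (hw r) (hwlaw r) i) (fun r hr => by
      have hi := indepFun_update hξ hx₀ hw hwindep hx₀w hξxw r
        (innovation Q i).measurable (prediction Q i).measurable
        (indepFun_innovation_prediction hQ (hw r) (hwlaw r) i)
      have hF : Measurable (predictFrom (S := S) Q i s) := measurable_predictFrom Q i s
      have hψ : Measurable fun p : Path M S =>
          ((B (predictFrom Q i s p), B (predictFrom Q i s p) * Z (predictFrom Q i s p)),
            Function.update (fun r' => innovation Q i (p.2.2 r')) r 0) := by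
        refine ((hBm.comp hF).prodMk ((hBm.comp hF).mul (hZm.comp hF))).prodMk
          (measurable_update'.comp (Measurable.prodMk (by fun_prop) measurable_const))
      have : IndepFun (fun ω => innovation Q i (w r ω)) _ μ := hi.comp measurable_id hψ
      convert this using 1
      funext ω
      have hup : predictFrom Q i s (ξ ω, x₀ ω,
          Function.update (fun j => w j ω) r (prediction Q i (w r ω))) = predictFrom Q i s (P ω) :=
        predictFrom_update Q i (Finset.mem_Ico.1 hr).1 (P ω)
      simp only [Function.comp, hup]
      refine Prod.ext (Prod.ext ?_ ?_) ?_
      · exact (hBp _).symm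
      · simp only [hBp, hP]
      · funext r'
        by_cases h : r' = r
        · subst h; simp
        · simp [Function.update_of_ne h])
  -- The bound `k ≤ t` keeps the subtraction in `s = t - k` from truncating.
  have hcard : ((Finset.Ico s t).card : ℝ) = k := by
    rw [Nat.card_Ico, hs, Nat.sub_sub_self hk]
  rw [hcard] at key
  have hnonneg : 0 ≤ ∫ ω, (B (P ω) * Z (predictFrom Q i s (P ω))) ^ 2 ∂μ :=
    integral_nonneg fun ω => sq_nonneg _
  calc _ ≤ ∫ ω, (B (P ω) * Z (predictFrom Q i s (P ω))) ^ 2 ∂μ +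
        k * (qTilde Q i * ∫ ω, B (P ω) ∂μ) := le_add_of_nonneg_left hnonneg
    _ = _ := by
      rw [← key]
      refine integral_congr_ae (ae_of_all _ fun ω => ?_)
      have hBsq : (B (P ω) * Z (P ω)) ^ 2 = B (P ω) * Z (P ω) ^ 2 := by
        rcases hB01 (P ω) with h | h <;> simp [h]
      simp only
      rw [herr]
      exact (congrArg (· ^ 2) (hdecomp (P ω)).symm).trans hBsq

end LowerBound

end Monitoring

/-! ### Summation over the values of the age. -/

theorem theorem2 {M : ℕ} {Ω S : Type*} [MeasurableSpace Ω] [MeasurableSpace S]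
    (μ : Measure Ω) [IsProbabilityMeasure μ]
    -- the covariance matrix of the increments
    (Q : Matrix (Fin M) (Fin M) ℝ) (hQ : Q.PosSemidef) (hQinv : IsUnit Q.det)
    -- the initial state, the increments and the random seed of the scheduler
    (x₀ : Ω → EuclideanSpace ℝ (Fin M)) (w : ℕ → Ω → EuclideanSpace ℝ (Fin M)) (ξ : Ω → S)
    (hx₀ : Measurable x₀) (hw : ∀ t, Measurable (w t)) (hξ : Measurable ξ)
    (hx₀2 : MemLp x₀ 2 μ)
    -- the increments are i.i.d. with law `N(0, Q)`
    (hwlaw : ∀ t, μ.map (w t) = multivariateGaussian 0 Q)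
    (hwindep : iIndepFun w μ)
    -- the initial state, the increments and the seed are mutually independent
    (hx₀w : IndepFun x₀ (fun ω t => w t ω) μ)
    (hξxw : IndepFun ξ (fun ω => (x₀ ω, fun t => w t ω)) μ)
    (pol : Monitoring.ObliviousPolicy M S) (i : Fin M) :
    0 < Monitoring.qTilde Q i ∧
      ∀ t : ℕ,
        Integrable (Monitoring.aoi pol ξ (Monitoring.state x₀ w) i t) μ ∧
        Integrable (Monitoring.sqError μ pol ξ (Monitoring.state x₀ w) i t) μ ∧
        Monitoring.qTilde Q i * ∫ ω, Monitoring.aoi pol ξ (Monitoring.state x₀ w) i t ω ∂μ ≤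
          ∫ ω, Monitoring.sqError μ pol ξ (Monitoring.state x₀ w) i t ω ∂μ := by
  have hQ' : Q.PosDef := hQ.posDef_iff_isUnit.2 ((Matrix.isUnit_iff_isUnit_det _).2 hQinv)
  refine ⟨Monitoring.qTilde_pos hQ' i, fun t => ?_⟩
  set x := Monitoring.state x₀ w with hx
  have hxm : ∀ t, Measurable (x t) := Monitoring.measurable_state hx₀ hw
  have hxL : MemLp (fun ω => x t ω i) 2 μ :=
    (EuclideanSpace.proj i : EuclideanSpace ℝ (Fin M) →L[ℝ] ℝ).comp_memLp'
      (Monitoring.memLp_state hx₀2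
        (fun t => (Monitoring.hasGaussianLaw_of_map_eq (hwlaw t)).memLp_two) t)
  have hmL : MemLp (Monitoring.mmse μ pol ξ x i t) 2 μ := hxL.condExp one_le_two
  have herr : Integrable (Monitoring.sqError μ pol ξ x i t) μ := (hxL.sub hmL).integrable_sq
  -- Doob–Dynkin: the conditional expectation factors through the record.
  obtain ⟨g, hg, hgm⟩ : ∃ g : (Fin (t + 1) → Fin M × ℝ) → ℝ, Measurable g ∧
      Monitoring.mmse μ pol ξ x i t = g ∘ Monitoring.record pol ξ x (t + 1) :=
    (stronglyMeasurable_condExp (m := Monitoring.info pol ξ x t)).measurable.exists_eq_measurable_comp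
  set P : Ω → Monitoring.Path M S := fun ω => (ξ ω, x₀ ω, fun r => w r ω) with hP
  have hPm : Measurable P := hξ.prodMk (hx₀.prodMk (measurable_pi_lambda _ hw))
  set b : ℕ → Ω → ℝ := fun k ω => if Monitoring.pathAge pol i t (P ω) = k then 1 else 0 with hb
  have hbm : ∀ k, Measurable (b k) := fun k => Measurable.ite
    (((Monitoring.measurable_pathAge pol i t).comp hPm) (measurableSet_singleton k))
    measurable_const measurable_const
  have hb1 : ∀ k ω, ‖b k ω‖ ≤ 1 := fun k ω => by
    simp only [hb]
    split_ifs <;> simp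
  have hbint : ∀ k, Integrable (b k) μ := fun k =>
    Integrable.of_bound (hbm k).aestronglyMeasurable 1 (ae_of_all _ (hb1 k))
  have hmem : ∀ ω, Monitoring.pathAge pol i t (P ω) ∈ Finset.range (t + 1) := fun ω =>
    Finset.mem_range.2 (Nat.lt_succ_of_le (Monitoring.age_le _ i t))
  have haoi : Monitoring.aoi pol ξ x i t = fun ω => ∑ k ∈ Finset.range (t + 1), k * b k ω := by
    funext ω
    rw [hx, Monitoring.aoi_eq_pathAge]
    simp only [hb, mul_ite, mul_one, mul_zero]
    rw [Finset.sum_ite_eq, if_pos (hmem ω)]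
  have hsq : Monitoring.sqError μ pol ξ x i t = fun ω => ∑ k ∈ Finset.range (t + 1),
      b k ω * (x t ω i - g (Monitoring.record pol ξ x (t + 1) ω)) ^ 2 := by
    funext ω
    rw [← Finset.sum_mul]
    simp only [hb]
    rw [Finset.sum_ite_eq, if_pos (hmem ω), one_mul, Monitoring.sqError, hgm]
    rfl
  have hsqint : ∀ k, Integrable
      (fun ω => b k ω * (x t ω i - g (Monitoring.record pol ξ x (t + 1) ω)) ^ 2) μ := fun k => by
    have : Integrable (fun ω => (x t ω i - g (Monitoring.record pol ξ x (t + 1) ω)) ^ 2) μ := by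
      convert herr using 2 with ω
      rw [Monitoring.sqError, hgm]
      rfl
    exact this.bdd_mul (hbm k).aestronglyMeasurable (ae_of_all _ (hb1 k))
  refine ⟨?_, herr, ?_⟩
  · rw [haoi]
    exact integrable_finsetSum _ fun k _ => (hbint k).const_mul _
  · rw [haoi, hsq, integral_finsetSum _ fun k _ => (hbint k).const_mul _,
      integral_finsetSum _ fun k _ => hsqint k, Finset.mul_sum]
    refine Finset.sum_le_sum fun k hk => ?_
    rw [integral_const_mul, mul_left_comm]
    exact Monitoring.mul_integral_indicator_le hQ' hx₀ hw hξ hx₀2 hwlaw hwindep hx₀w hξxw i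
      (Nat.lt_succ_iff.1 (Finset.mem_range.1 hk)) hg
      (hmL.ae_eq (ae_of_all _ (congrFun hgm)))
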